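/- Theorem 1.3. Let $n,\ell$ be integers with $1\le \ell\le n/2$, let $V$ be a set of $n$ vertices, and let $\{X_t\}_{t\ge 0}$ be the unlabelled exclusion process on the complete graph on $V$ with intensity $\alpha=2/n^2$, that is, the continuous-time Markov chain on the set $\binom{V}{\ell}$ of $\ell$-element subsets of $V$ whose generator has entries $q_{J,J}=-\alpha\ell(n-\ell)$, $q_{J,J'}=\alpha$ if $|J\,\triangle\, J'|=2$, and $q_{J,J'}=0$ otherwise, started from an arbitrary fixed state $X_0=J_0$. Let $\pi$ be the uniform distribution on $\binom{V}{\ell}$, let $\|\nu\|_2^2=\sum_{s}\left|\nu(s)/\pi(s)\right|^2\pi(s)$ for signed measures $\nu$ on $\binom{V}{\ell}$, and for $\varepsilon\in(0,1)$ let $\tau_2(\varepsilon)=\inf\{t\ge 0:\max_{J_0}\|\mathbb P_{J_0}(X_t\in\cdot)-\pi\|_2\le 2\varepsilon\}$. (a) For all $1\le\ell\le n/2$, all initial states $J_0$ and all $t\ge 0$, $$\|\mathbb P_{J_0}(X_t\in\cdot)-\pi\|_2^2=\sum_{i=1}^{\ell}\left(\binom{n}{i}-\binom{n}{i-1}\right)e^{-4i(n-i+1)t/n^2}.$$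 (b) For all $1\le\ell\le n/2$, all $J_0$ and all real $c$ such that $t=\frac14 n\log(n-1)+cn\ge 0$, $$e^{-2c}\le\|\mathbb P_{J_0}(X_t\in\cdot)-\pi\|_2 .$$ (c) There is an absolute constant $N$ such that for all $n\ge N$, all $1\le\ell\le n/2$, all $J_0$ and all $c\ge 0$, at time $t=\frac14 n\log(n-1)+cn$, $$\|\mathbb P_{J_0}(X_t\in\cdot)-\pi\|_2\le 2e^{-2c}.$$ (d) For every $\varepsilon\in(0,1)$ there is a constant $C(\varepsilon)$, depending only on $\varepsilon$, such that for all $1\le\ell\le n/2$ the infimum defining $\tau_2(\varepsilon)$ is over a nonempty set and $$\left|\tau_2(\varepsilon)-\tfrac14 n\log n\right|\le C(\varepsilon)\,n .$$ -/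

import Mathlib

noncomputable section

/-- Configurations of the unlabelled exclusion process on the complete graph with vertex set
`Fin n`: the `ℓ`-element sets of vertices (those occupied by black balls). -/
abbrev UEPState (n ℓ : ℕ) : Type := {J : Finset (Fin n) // J.card = ℓ}

/-- The generator of the unlabelled exclusion process with parameter `ℓ` and intensity `α`. -/
def uepGenerator (n ℓ : ℕ) (α : ℝ) : Matrix (UEPState n ℓ) (UEPState n ℓ) ℝ :=
  Matrix.of fun J J' =>
    if J = J' then -(α * ℓ * ((n : ℝ) - ℓ))
    else if (symmDiff J.1 J'.1).card = 2 then α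
    else 0

/-- The transition function `P_t = exp (t Q)` of the continuous-time Markov chain with generator
`Q` on a finite state space: `transitionProb Q t x y` is the probability that `X_t = y` when the
chain is started from `X_0 = x`. -/
def transitionProb {S : Type*} [Fintype S] [DecidableEq S] (Q : Matrix S S ℝ) (t : ℝ)
    (x y : S) : ℝ :=
  (NormedSpace.exp (t • Q) : Matrix S S ℝ) x y

/-- The uniform distribution on a finite set. -/
def uniformDist (S : Type*) [Fintype S] : S → ℝ := fun _ => 1 / (Fintype.card S : ℝ)

/-- The `L²(π)` norm of a signed measure `ν` on a finite set (both given by their point masses). -/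
def l2Norm {S : Type*} [Fintype S] (π ν : S → ℝ) : ℝ :=
  √(∑ s, |ν s / π s| ^ 2 * π s)

/-- The `L²` distance from uniform of the law of `X_t`, for the unlabelled exclusion process
with intensity `α = 2 / n²` started from the configuration `J`. -/
def uepL2Dist (n ℓ : ℕ) (J : UEPState n ℓ) (t : ℝ) : ℝ :=
  l2Norm (uniformDist (UEPState n ℓ))
    (fun J' => transitionProb (uepGenerator n ℓ (2 / (n : ℝ) ^ 2)) t J J' -
      uniformDist (UEPState n ℓ) J')

/-- The times `t ≥ 0` at which the `L²` distance from uniform, maximized over the initial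
configuration, is at most `2 ε`. -/
def uepL2MixedTimes (n ℓ : ℕ) (ε : ℝ) : Set ℝ :=
  {t | 0 ≤ t ∧ ∀ J : UEPState n ℓ, uepL2Dist n ℓ J t ≤ 2 * ε}

/-- The `L²` mixing time `τ₂(ε)` of the unlabelled exclusion process with `α = 2 / n²`. -/
def uepL2MixingTime (n ℓ : ℕ) (ε : ℝ) : ℝ := sInf (uepL2MixedTimes n ℓ ε)

end

/-!
The process is symmetric and vertex transitive, so the squared `L²` distance at time `t` equals
`tr (exp (2 t Q)) - 1`, and only the spectrum of the generator with its multiplicities matters.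

These are obtained without diagonalizing. Let `W` be the inclusion matrix of `k`-sets in
`(k + 1)`-sets and `μ = (k + 1) (n - k)`. The generators on `(k + 1)`-sets and on `k`-sets are
`α (W Wᵀ - μ)` and `α (Wᵀ W - μ)`, with the same `μ` (`uepGenerator_succ_eq`, `uepGenerator_eq`).
As `(W Wᵀ) ^ j` and `(Wᵀ W) ^ j` have equal traces for `j ≥ 1`, the traces of the two semigroups
differ by `(n.choose (k + 1) - n.choose k) e ^ (-s α μ)`, and induction on the number of particles
gives the exact formula (`trace_exp_uepGenerator`, `uepL2Dist_sq`).

The lower bound is the summand `i = 1`. For the upper bound at time `n log (n - 1) / 4 + c n`, all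
nonzero eigenvalues are at least the spectral gap in absolute value, which yields the factor
`e ^ (-4 c)`; what remains is majorized termwise by `eigenMajorant n i`, which converges to `1 / i!`
and is dominated by a summable sequence, so that the sum converges to `e < 4`. The convergent
sequence of sums is also bounded, which controls the mixing time for all `n` at once.
-/

open NormedSpace Filter Topology

/-! ### Exponentials of real matrices -/

section MatrixExp

variable {S T : Type*} [Fintype S] [DecidableEq S] [Fintype T] [DecidableEq T]

theorem Matrix.hasSum_exp_real (A : Matrix S S ℝ) :
    HasSum (fun k : ℕ => ((k.factorial : ℝ)⁻¹) • A ^ k) (exp A) := by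
  -- The norm only serves to sum the series; the topology is the entrywise one.
  let _ : NormedRing (Matrix S S ℝ) := Matrix.linftyOpNormedRing
  let _ : NormedAlgebra ℝ (Matrix S S ℝ) := Matrix.linftyOpNormedAlgebra
  exact NormedSpace.exp_series_hasSum_exp' (𝕂 := ℝ) A

theorem Matrix.hasSum_trace_exp (A : Matrix S S ℝ) :
    HasSum (fun k : ℕ => ((k.factorial : ℝ)⁻¹) * (A ^ k).trace) (exp A).trace := by
  have h := A.hasSum_exp_real.map (Matrix.traceAddMonoidHom S ℝ)
    (continuous_id.matrix_trace)
  simpa [Function.comp_def, Matrix.trace_smul] using h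

theorem Matrix.trace_mul_pow_succ_comm (M : Matrix S T ℝ) (N : Matrix T S ℝ) (k : ℕ) :
    ((M * N) ^ (k + 1)).trace = ((N * M) ^ (k + 1)).trace := by
  have h : ∀ j : ℕ, (M * N) ^ j * M = M * (N * M) ^ j := by
    intro j
    induction j with
    | zero => simp
    | succ j ih => rw [pow_succ', Matrix.mul_assoc, ih, pow_succ', Matrix.mul_assoc,
        Matrix.mul_assoc]
  rw [pow_succ, ← Matrix.mul_assoc, h, Matrix.mul_assoc, Matrix.trace_mul_comm, Matrix.mul_assoc,
    ← pow_succ]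

/-- `M * N` and `N * M` have the same nonzero eigenvalues, so the traces of their exponentials
differ only through the multiplicity of the eigenvalue `0`, that is, by the difference of the
sizes. -/
theorem Matrix.trace_exp_mul_comm (M : Matrix S T ℝ) (N : Matrix T S ℝ) :
    (exp (M * N)).trace - Fintype.card S = (exp (N * M)).trace - Fintype.card T := by
  have h1 := (M * N).hasSum_trace_exp
  have h2 := (N * M).hasSum_trace_exp
  have h3 := (hasSum_nat_add_iff' 1).2 h1
  have h4 := (hasSum_nat_add_iff' 1).2 h2
  simp only [Finset.range_one, Finset.sum_singleton, Nat.factorial_zero, Nat.cast_one, inv_one,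
    pow_zero, Matrix.trace_one, one_mul] at h3 h4
  refine h3.unique ?_
  simpa only [Matrix.trace_mul_pow_succ_comm M N] using h4

theorem Matrix.exp_sub_scalar (A : Matrix S S ℝ) (c : ℝ) :
    exp (A - c • (1 : Matrix S S ℝ)) = Real.exp (-c) • exp A := by
  have h : A - c • (1 : Matrix S S ℝ) = (-c) • (1 : Matrix S S ℝ) + A := by
    rw [neg_smul]; abel
  rw [h, Matrix.exp_add_of_commute _ _ ((Commute.one_left A).smul_left (-c)),
    ← Matrix.diagonal_one, ← Matrix.diagonal_smul, Matrix.exp_diagonal]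
  have : exp ((-c) • (1 : S → ℝ)) = (Real.exp (-c)) • (1 : S → ℝ) := by
    funext s
    rw [Pi.coe_exp]
    simp [Real.exp_eq_exp_ℝ]
  rw [show (fun _ : S => (1 : ℝ)) = 1 from rfl, this, Matrix.diagonal_smul,
    show Matrix.diagonal (1 : S → ℝ) = 1 from Matrix.diagonal_one, smul_mul_assoc, one_mul]

theorem Matrix.exp_submatrix_equiv_self (A : Matrix S S ℝ) (e : S ≃ S)
    (h : A.submatrix e e = A) : (exp A).submatrix e e = exp A := by
  have hp : ∀ k : ℕ, (A ^ k).submatrix e e = A ^ k := by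
    intro k
    induction k with
    | zero => simp
    | succ k ih => rw [pow_succ, ← Matrix.submatrix_mul_equiv _ _ e e e, ih, h]
  have h1 := A.hasSum_exp_real
  ext x y
  have hxy : ∀ x y, HasSum (fun k : ℕ => ((k.factorial : ℝ)⁻¹) * (A ^ k) x y) (exp A x y) := by
    intro x y
    simpa using Pi.hasSum.1 (Pi.hasSum.1 h1 x) y
  refine (hxy (e x) (e y)).unique ?_
  have : ∀ k : ℕ, (A ^ k) (e x) (e y) = (A ^ k) x y := fun k => congrFun (congrFun (hp k) x) y
  simpa only [this] using hxy x y

/-- The exponential of a matrix with vanishing row sums has row sums one. -/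
theorem Matrix.sum_exp_row_eq_one (A : Matrix S S ℝ) (h : ∀ x, ∑ y, A x y = 0) (x : S) :
    ∑ y, exp A x y = 1 := by
  have hrow : HasSum (fun k : ℕ => ∑ y, ((k.factorial : ℝ)⁻¹) * (A ^ k) x y)
      (∑ y, exp A x y) :=
    hasSum_sum fun y _ => by simpa using Pi.hasSum.1 (Pi.hasSum.1 A.hasSum_exp_real x) y
  refine hrow.unique ?_
  convert hasSum_single (f := fun k : ℕ => ∑ y, ((k.factorial : ℝ)⁻¹) * (A ^ k) x y) 0 ?_ using 1
  · simp [Matrix.one_apply]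
  · intro k hk
    obtain ⟨j, rfl⟩ := Nat.exists_eq_succ_of_ne_zero hk
    simp only [← Finset.mul_sum, Nat.succ_eq_add_one, pow_succ, Matrix.mul_apply]
    rw [Finset.sum_comm]
    simp [← Finset.mul_sum, h]

end MatrixExp

/-! ### The generator and inclusion matrices -/

/-- The inclusion matrix of `k`-sets in `(k + 1)`-sets: the entry at `(J, K)` is `1` if `K ⊆ J`
and `0` otherwise. -/
def inclusionMatrix (n k : ℕ) : Matrix (UEPState n (k + 1)) (UEPState n k) ℝ :=
  Matrix.of fun J K => if K.1 ⊆ J.1 then 1 else 0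

theorem card_uepState (n ℓ : ℕ) : Fintype.card (UEPState n ℓ) = n.choose ℓ := by
  rw [Fintype.card_finset_len, Fintype.card_fin]

theorem card_symmDiff_eq_two_iff {n k : ℕ} (J J' : UEPState n k) :
    (symmDiff J.1 J'.1).card = 2 ↔ (J.1 ∩ J'.1).card + 1 = k := by
  have h1 := Finset.card_sdiff_add_card_inter J.1 J'.1
  have h2 := Finset.card_sdiff_add_card_inter J'.1 J.1
  have h3 : (symmDiff J.1 J'.1).card = (J.1 \ J'.1).card + (J'.1 \ J.1).card := by
    rw [symmDiff, Finset.sup_eq_union, Finset.card_union_of_disjoint disjoint_sdiff_sdiff]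
  rw [Finset.inter_comm, J'.2] at h2
  rw [J.2] at h1
  omega

theorem card_inter_lt {n k : ℕ} {J J' : UEPState n k} (h : J ≠ J') :
    (J.1 ∩ J'.1).card < k := by
  by_contra hc
  have h1 : J.1 ∩ J'.1 = J.1 :=
    Finset.eq_of_subset_of_card_le Finset.inter_subset_left (by rw [J.2]; omega)
  have h2 : J.1 ∩ J'.1 = J'.1 :=
    Finset.eq_of_subset_of_card_le Finset.inter_subset_right (by rw [J'.2]; omega)
  exact h (Subtype.ext (h1.symm.trans h2))

theorem card_union_eq {n k : ℕ} (K K' : UEPState n k) :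
    (K.1 ∪ K'.1).card + (K.1 ∩ K'.1).card = 2 * k := by
  rw [Finset.card_union_add_card_inter, K.2, K'.2, two_mul]

theorem card_filter_subset (n k : ℕ) (A : Finset (Fin n)) :
    (Finset.univ.filter fun K : UEPState n k => K.1 ⊆ A).card = A.card.choose k := by
  rw [← Finset.card_powersetCard, ← Finset.card_map (Function.Embedding.subtype _)]
  congr 1
  ext K
  simp [Finset.mem_powersetCard, and_comm]

theorem card_filter_superset {n k : ℕ} (hk : k ≤ n) (A : Finset (Fin n)) :
    (Finset.univ.filter fun J : UEPState n k => A ⊆ J.1).card =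
      (n - A.card).choose (n - k) := by
  have hc : Aᶜ.card = n - A.card := by rw [Finset.card_compl, Fintype.card_fin]
  rw [← hc, ← card_filter_subset n (n - k) Aᶜ]
  refine Finset.card_bij' (fun J _ => ⟨J.1ᶜ, by rw [Finset.card_compl, Fintype.card_fin, J.2]⟩)
    (fun J _ => ⟨J.1ᶜ, by rw [Finset.card_compl, Fintype.card_fin, J.2]; omega⟩) ?_ ?_ ?_ ?_
  · simp
  · intro J hJ
    simp only [Finset.mem_filter, Finset.mem_univ, true_and] at hJ ⊢
    exact Finset.subset_compl_comm.1 hJ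
  · simp
  · simp

theorem inclusionMatrix_mul_transpose (n k : ℕ) (J J' : UEPState n (k + 1)) :
    (inclusionMatrix n k * (inclusionMatrix n k).transpose) J J' =
      if J = J' then (k : ℝ) + 1 else if (symmDiff J.1 J'.1).card = 2 then 1 else 0 := by
  have h : (inclusionMatrix n k * (inclusionMatrix n k).transpose) J J' =
      ((J.1 ∩ J'.1).card.choose k : ℝ) := by
    rw [← card_filter_subset]
    simp [inclusionMatrix, Matrix.mul_apply, Finset.subset_inter_iff, ← ite_and, Finset.sum_boole,
      and_comm]
  rw [h]
  split_ifs with h1 h2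
  · subst h1
    simp [J.2]
  · rw [card_symmDiff_eq_two_iff] at h2
    rw [show (J.1 ∩ J'.1).card = k by omega]
    simp
  · rw [card_symmDiff_eq_two_iff] at h2
    have := card_inter_lt h1
    rw [Nat.choose_eq_zero_of_lt (by omega)]
    simp

theorem transpose_mul_inclusionMatrix {n k : ℕ} (hk : k + 1 ≤ n) (K K' : UEPState n k) :
    ((inclusionMatrix n k).transpose * inclusionMatrix n k) K K' =
      if K = K' then (n : ℝ) - k else if (symmDiff K.1 K'.1).card = 2 then 1 else 0 := by
  have h : ((inclusionMatrix n k).transpose * inclusionMatrix n k) K K' =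
      ((n - (K.1 ∪ K'.1).card).choose (n - (k + 1)) : ℝ) := by
    rw [← card_filter_superset hk]
    simp [inclusionMatrix, Matrix.mul_apply, Finset.union_subset_iff, ← ite_and, Finset.sum_boole,
      and_comm]
  have hu := card_union_eq K K'
  rw [h]
  split_ifs with h1 h2
  · subst h1
    rw [Finset.union_self, K.2, show n - k = n - (k + 1) + 1 by omega, Nat.choose_succ_self_right,
      show n - (k + 1) + 1 = n - k by omega, Nat.cast_sub (by omega)]
  · rw [card_symmDiff_eq_two_iff] at h2
    rw [show (K.1 ∪ K'.1).card = k + 1 by omega]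
    simp
  · rw [card_symmDiff_eq_two_iff] at h2
    have := card_inter_lt h1
    have hle : (K.1 ∪ K'.1).card ≤ n := by simpa using Finset.card_le_univ (K.1 ∪ K'.1)
    rw [Nat.choose_eq_zero_of_lt (by omega)]
    simp

/-- The generator on `(k + 1)`-sets, through the inclusion matrix from below. -/
theorem uepGenerator_succ_eq (n k : ℕ) (α : ℝ) :
    uepGenerator n (k + 1) α =
      α • (inclusionMatrix n k * (inclusionMatrix n k).transpose) -
        (α * (((k : ℝ) + 1) * ((n : ℝ) - k))) • (1 : Matrix _ _ ℝ) := by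
  ext J J'
  rw [Matrix.sub_apply, Matrix.smul_apply, Matrix.smul_apply, inclusionMatrix_mul_transpose,
    Matrix.one_apply]
  simp only [uepGenerator, Matrix.of_apply, smul_eq_mul]
  split_ifs <;> push_cast <;> ring

/-- The generator on `k`-sets, through the inclusion matrix from above; the scalar is the same as
in `uepGenerator_succ_eq`. -/
theorem uepGenerator_eq {n k : ℕ} (hk : k + 1 ≤ n) (α : ℝ) :
    uepGenerator n k α =
      α • ((inclusionMatrix n k).transpose * inclusionMatrix n k) -
        (α * (((k : ℝ) + 1) * ((n : ℝ) - k))) • (1 : Matrix _ _ ℝ) := by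
  ext J J'
  rw [Matrix.sub_apply, Matrix.smul_apply, Matrix.smul_apply, transpose_mul_inclusionMatrix hk,
    Matrix.one_apply]
  simp only [uepGenerator, Matrix.of_apply, smul_eq_mul]
  split_ifs <;> ring

theorem trace_exp_uepGenerator_succ {n k : ℕ} (hk : k + 1 ≤ n) (α s : ℝ) :
    (exp (s • uepGenerator n (k + 1) α)).trace =
      (exp (s • uepGenerator n k α)).trace + ((n.choose (k + 1) : ℝ) - n.choose k) *
        Real.exp (-(s * (α * (((k : ℝ) + 1) * ((n : ℝ) - k))))) := by
  have h := Matrix.trace_exp_mul_comm ((s * α) • inclusionMatrix n k)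
    (inclusionMatrix n k).transpose
  rw [card_uepState, card_uepState, Matrix.smul_mul, Matrix.mul_smul] at h
  rw [uepGenerator_succ_eq, uepGenerator_eq hk, smul_sub, smul_sub, smul_smul, smul_smul, smul_smul,
    smul_smul, Matrix.exp_sub_scalar, Matrix.exp_sub_scalar, Matrix.trace_smul, Matrix.trace_smul,
    smul_eq_mul, smul_eq_mul]
  linear_combination Real.exp (-(s * (α * (((k : ℝ) + 1) * ((n : ℝ) - k))))) * h

/-- Each step `ℓ - 1 → ℓ` adds the eigenvalue `-α ℓ (n - ℓ + 1)` with multiplicity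
`n.choose ℓ - n.choose (ℓ - 1)`. -/
theorem trace_exp_uepGenerator {n ℓ : ℕ} (hℓ : ℓ ≤ n) (α s : ℝ) :
    (exp (s • uepGenerator n ℓ α)).trace =
      1 + ∑ i ∈ Finset.Icc 1 ℓ, ((n.choose i : ℝ) - (n.choose (i - 1) : ℝ)) *
        Real.exp (-(s * (α * ((i : ℝ) * ((n : ℝ) - i + 1))))) := by
  induction ℓ with
  | zero =>
    have h0 : uepGenerator n 0 α = 0 := by
      ext J J'
      have : J = J' := Subtype.ext (by
        rw [Finset.card_eq_zero.1 J.2, Finset.card_eq_zero.1 J'.2])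
      simp [uepGenerator, this]
    simp [h0, Matrix.trace_one]
  | succ k ih =>
    rw [trace_exp_uepGenerator_succ hℓ, ih (by omega), Finset.sum_Icc_succ_top (by omega),
      add_assoc, Nat.add_sub_cancel]
    congr 6
    push_cast
    ring

/-! ### The `L²` distance as a trace -/

theorem uepGenerator_isSymm (n ℓ : ℕ) (α : ℝ) : (uepGenerator n ℓ α).IsSymm := by
  ext J J'
  simp [uepGenerator, Matrix.transpose_apply, eq_comm, symmDiff_comm]

theorem sum_uepGenerator_row (n ℓ : ℕ) (α : ℝ) (J : UEPState n ℓ) :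
    ∑ J', uepGenerator n ℓ α J J' = 0 := by
  cases ℓ with
  | zero =>
    refine Finset.sum_eq_zero fun J' _ => ?_
    have : J = J' := Subtype.ext (by rw [Finset.card_eq_zero.1 J.2, Finset.card_eq_zero.1 J'.2])
    simp [uepGenerator, this]
  | succ k =>
    have hkn : k + 1 ≤ n := by
      have := Finset.card_le_univ J.1
      rwa [J.2, Fintype.card_fin] at this
    -- A row sum of the inclusion matrix counts the `k`-subsets of `J`, and a column sum the
    -- `(k + 1)`-sets containing a given `k`-set.
    have hrow : ∑ K, inclusionMatrix n k J K = (k : ℝ) + 1 := by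
      have := card_filter_subset n k J.1
      rw [J.2, Nat.choose_succ_self_right] at this
      simp [inclusionMatrix, Finset.sum_boole, this]
    have hcol : ∀ K, ∑ J', inclusionMatrix n k J' K = (n : ℝ) - k := by
      intro K
      have := card_filter_superset hkn K.1
      rw [K.2, show n - k = n - (k + 1) + 1 by omega, Nat.choose_succ_self_right,
        show n - (k + 1) + 1 = n - k by omega] at this
      simp [inclusionMatrix, Finset.sum_boole, this, Nat.cast_sub (show k ≤ n by omega)]
    have h1 : ∑ J', (inclusionMatrix n k * (inclusionMatrix n k).transpose) J J' =
        ((k : ℝ) + 1) * ((n : ℝ) - k) := by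
      simp only [Matrix.mul_apply, Matrix.transpose_apply]
      rw [Finset.sum_comm]
      simp only [← Finset.mul_sum, hcol, ← Finset.sum_mul, hrow]
    simp only [uepGenerator_succ_eq, Matrix.sub_apply, Matrix.smul_apply, smul_eq_mul,
      Finset.sum_sub_distrib, ← Finset.mul_sum, h1, Matrix.one_apply]
    simp

/-- The permutation of configurations induced by a permutation of the vertices. -/
def uepStatePerm {n : ℕ} (ℓ : ℕ) (σ : Equiv.Perm (Fin n)) : UEPState n ℓ ≃ UEPState n ℓ :=
  (Equiv.finsetCongr σ).subtypeEquiv fun J => by simp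

theorem exists_uepStatePerm_eq {n ℓ : ℕ} (J J' : UEPState n ℓ) :
    ∃ σ : Equiv.Perm (Fin n), uepStatePerm ℓ σ J = J' := by
  have e : {x // x ∈ J.1} ≃ {x // x ∈ J'.1} :=
    Fintype.equivOfCardEq (by simp [J.2, J'.2])
  refine ⟨e.extendSubtype, Subtype.ext ?_⟩
  refine Finset.eq_of_subset_of_card_le ?_ (by simp [uepStatePerm, J.2, J'.2])
  intro x hx
  simp only [uepStatePerm, Equiv.subtypeEquiv_apply, Equiv.finsetCongr_apply, Finset.mem_map,
    Equiv.coe_toEmbedding] at hx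
  obtain ⟨y, hy, rfl⟩ := hx
  exact e.extendSubtype_mem y hy

theorem uepGenerator_submatrix_perm {n : ℕ} (ℓ : ℕ) (α : ℝ) (σ : Equiv.Perm (Fin n)) :
    (uepGenerator n ℓ α).submatrix (uepStatePerm ℓ σ) (uepStatePerm ℓ σ) =
      uepGenerator n ℓ α := by
  ext J J'
  have h : symmDiff (uepStatePerm ℓ σ J).1 (uepStatePerm ℓ σ J').1 =
      (symmDiff J.1 J'.1).map σ.toEmbedding := by
    simp [uepStatePerm, Finset.map_eq_image, Finset.image_symmDiff _ _ σ.injective]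
  simp only [uepGenerator, Matrix.submatrix_apply, Matrix.of_apply, h, Finset.card_map,
    EmbeddingLike.apply_eq_iff_eq]

/-- By vertex transitivity all return probabilities are equal. -/
theorem exp_uepGenerator_diag {n ℓ : ℕ} (α s : ℝ) (J : UEPState n ℓ) :
    (Fintype.card (UEPState n ℓ) : ℝ) * exp (s • uepGenerator n ℓ α) J J =
      (exp (s • uepGenerator n ℓ α)).trace := by
  rw [Matrix.trace, Finset.sum_congr rfl (g := fun _ => exp (s • uepGenerator n ℓ α) J J)]
  · simp
  · intro J' _
    obtain ⟨σ, rfl⟩ := exists_uepStatePerm_eq J J'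
    have h := Matrix.exp_submatrix_equiv_self (s • uepGenerator n ℓ α) (uepStatePerm ℓ σ)
      (congrArg (s • ·) (uepGenerator_submatrix_perm ℓ α σ))
    exact congrFun (congrFun h J) J

/-- The squared `L²` distance at time `t` is the return probability at time `2 t` relative to the
uniform one, minus one; that return probability is the average of the diagonal. -/
theorem uepL2Dist_sq_eq_trace {n ℓ : ℕ} (J : UEPState n ℓ) (t : ℝ) :
    uepL2Dist n ℓ J t ^ 2 =
      (exp ((2 * t) • uepGenerator n ℓ (2 / (n : ℝ) ^ 2))).trace - 1 := by
  set Q := uepGenerator n ℓ (2 / (n : ℝ) ^ 2) with hQ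
  set c : ℝ := (Fintype.card (UEPState n ℓ) : ℝ) with hc
  have hc0 : c ≠ 0 := by
    rw [hc]; exact_mod_cast (Fintype.card_pos_iff.2 ⟨J⟩).ne'
  have hcp : 0 < c := lt_of_le_of_ne (by positivity) hc0.symm
  have hsum : ∑ J', exp (t • Q) J J' = 1 := by
    refine Matrix.sum_exp_row_eq_one _ (fun x => ?_) J
    simp only [Matrix.smul_apply, smul_eq_mul, ← Finset.mul_sum, hQ, sum_uepGenerator_row, mul_zero]
  have hsq : ∑ J', exp (t • Q) J J' ^ 2 = exp ((2 * t) • Q) J J := by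
    have h2 : (2 * t) • Q = t • Q + t • Q := by rw [two_mul, add_smul]
    rw [h2, Matrix.exp_add_of_commute _ _ (Commute.refl _), Matrix.mul_apply]
    refine Finset.sum_congr rfl fun J' _ => ?_
    have hs : (exp (t • Q)).IsSymm := ((uepGenerator_isSymm n ℓ _).smul t).exp
    rw [sq, hs.apply]
  rw [uepL2Dist, l2Norm, Real.sq_sqrt
    (Finset.sum_nonneg fun s _ => mul_nonneg (by positivity) (by unfold uniformDist; positivity))]
  rw [← exp_uepGenerator_diag _ _ J, ← hQ, ← hc, ← hsq]
  have : ∀ J' : UEPState n ℓ, |(transitionProb Q t J J' - uniformDist (UEPState n ℓ) J') /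
      uniformDist (UEPState n ℓ) J'| ^ 2 * uniformDist (UEPState n ℓ) J' =
      c * exp (t • Q) J J' ^ 2 - 2 * exp (t • Q) J J' + 1 / c := by
    intro J'
    rw [sq_abs]
    simp only [uniformDist, transitionProb, ← hc]
    field_simp
    ring
  simp only [this, Finset.sum_add_distrib, Finset.sum_sub_distrib, ← Finset.mul_sum, hsum,
    Finset.sum_const, Finset.card_univ, nsmul_eq_mul, ← hc]
  field_simp
  ring

theorem uepL2Dist_sq {n ℓ : ℕ} (hℓ : ℓ ≤ n) (J : UEPState n ℓ) (t : ℝ) :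
    uepL2Dist n ℓ J t ^ 2 =
      ∑ i ∈ Finset.Icc 1 ℓ, ((n.choose i : ℝ) - (n.choose (i - 1) : ℝ)) *
        Real.exp (-(4 * (i : ℝ) * ((n : ℝ) - i + 1) * t / (n : ℝ) ^ 2)) := by
  rw [uepL2Dist_sq_eq_trace, trace_exp_uepGenerator hℓ, add_sub_cancel_left]
  refine Finset.sum_congr rfl fun i _ => ?_
  congr 3
  ring

/-! ### Asymptotics of the eigenvalue sum -/

/-- The `i`-th summand of a majorant of the squared `L²` distance at time `n log (n - 1) / 4`,
obtained from `n.choose i ≤ n ^ i / i!`. It tends to `1 / i!` as `n → ∞`; the summand `i = 0`,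
equal to `1`, is included so that the limits add up to `e`. -/
noncomputable def eigenMajorant (n i : ℕ) : ℝ :=
  if 2 * i ≤ n then
    Real.exp (i * (Real.log n - Real.log ((n : ℝ) - 1)) +
      i * ((i : ℝ) - 1) * (Real.log ((n : ℝ) - 1) / n)) / i.factorial
  else 0

theorem eigenMajorant_nonneg (n i : ℕ) : 0 ≤ eigenMajorant n i := by
  unfold eigenMajorant; split_ifs <;> positivity

theorem tendsto_log_sub_log_sub_one :
    Tendsto (fun n : ℕ => Real.log n - Real.log ((n : ℝ) - 1)) atTop (𝓝 0) := by
  have h : Tendsto (fun n : ℕ => Real.log (1 - (n : ℝ)⁻¹)) atTop (𝓝 0) := by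
    have h1 : Tendsto (fun n : ℕ => 1 - (n : ℝ)⁻¹) atTop (𝓝 (1 - 0)) :=
      tendsto_const_nhds.sub (tendsto_inv_atTop_zero.comp tendsto_natCast_atTop_atTop)
    rw [sub_zero] at h1
    simpa using h1.log one_ne_zero
  have h' := h.neg
  rw [neg_zero] at h'
  refine h'.congr' ?_
  filter_upwards [eventually_ge_atTop 2] with n hn
  have hn' : (2 : ℝ) ≤ n := by exact_mod_cast hn
  have : (1 : ℝ) - (n : ℝ)⁻¹ = ((n : ℝ) - 1) / n := by field_simp
  rw [this, Real.log_div (by linarith) (by linarith)]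
  ring

theorem tendsto_log_sub_one_div :
    Tendsto (fun n : ℕ => Real.log ((n : ℝ) - 1) / n) atTop (𝓝 0) := by
  have h0 : Tendsto (fun n : ℕ => Real.log n / (n : ℝ)) atTop (𝓝 0) :=
    (Real.isLittleO_log_id_atTop.tendsto_div_nhds_zero).comp tendsto_natCast_atTop_atTop
  refine squeeze_zero' ?_ ?_ h0
  · filter_upwards [eventually_ge_atTop 2] with n hn
    have hn' : (2 : ℝ) ≤ n := by exact_mod_cast hn
    exact div_nonneg (Real.log_nonneg (by linarith)) (by linarith)
  · filter_upwards [eventually_ge_atTop 2] with n hn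
    have hn' : (2 : ℝ) ≤ n := by exact_mod_cast hn
    gcongr
    · linarith
    · linarith

theorem tendsto_eigenMajorant (i : ℕ) :
    Tendsto (fun n => eigenMajorant n i) atTop (𝓝 (1 / (i.factorial : ℝ))) := by
  have h := ((tendsto_log_sub_log_sub_one.const_mul (i : ℝ)).add
    (tendsto_log_sub_one_div.const_mul ((i : ℝ) * ((i : ℝ) - 1)))).rexp.div_const
      (i.factorial : ℝ)
  rw [mul_zero, mul_zero, add_zero, Real.exp_zero] at h
  refine h.congr' ?_
  filter_upwards [eventually_ge_atTop (2 * i)] with n hn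
  rw [eigenMajorant, if_pos hn]

/-- For `2 i ≤ n`, the exponent is at most `i log 2 + i log (2 i) / 2`, because `log x / x` is
decreasing; hence the square of the summand is at most `(8 i) ^ i / (i!) ^ 2`. -/
theorem eigenMajorant_sq_le {n : ℕ} (hn : 2 ≤ n) (i : ℕ) :
    eigenMajorant n i ^ 2 ≤ (8 * i : ℝ) ^ i / (i.factorial : ℝ) ^ 2 := by
  unfold eigenMajorant
  split_ifs with h
  · rw [div_pow]
    gcongr
    rcases Nat.eq_zero_or_pos i with rfl | hi
    · simp
    have hn' : (2 : ℝ) ≤ n := by exact_mod_cast hn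
    have hi' : (1 : ℝ) ≤ i := by exact_mod_cast hi
    have hin : 2 * (i : ℝ) ≤ n := by exact_mod_cast h
    have h1 : Real.log n - Real.log ((n : ℝ) - 1) ≤ Real.log 2 := by
      rw [sub_le_iff_le_add, ← Real.log_mul (by norm_num) (by linarith)]
      exact Real.log_le_log (by linarith) (by linarith)
    have h2 : ((i : ℝ) - 1) * (Real.log ((n : ℝ) - 1) / n) ≤ Real.log (2 * i) / 2 := by
      rcases Nat.lt_or_ge i 2 with hi2 | hi2
      · obtain rfl : i = 1 := by omega
        simpa using div_nonneg (Real.log_nonneg one_le_two) zero_le_two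
      have hi2' : (2 : ℝ) ≤ i := by exact_mod_cast hi2
      have he := Real.exp_one_lt_three
      have h3 : Real.log n / n ≤ Real.log (2 * i) / (2 * i) :=
        Real.log_div_self_antitoneOn (by simp only [Set.mem_Ici]; linarith)
          (by simp only [Set.mem_Ici]; linarith) hin
      have h4 : Real.log ((n : ℝ) - 1) / n ≤ Real.log n / n := by
        gcongr
        · linarith
        · linarith
      calc ((i : ℝ) - 1) * (Real.log ((n : ℝ) - 1) / n)
          ≤ i * (Real.log (2 * i) / (2 * i)) :=
            mul_le_mul (by linarith) (h4.trans h3)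
              (div_nonneg (Real.log_nonneg (by linarith)) (by linarith)) (by linarith)
        _ = Real.log (2 * i) / 2 := by field_simp
    have h5 : (8 * i : ℝ) ^ i =
        Real.exp (i * (2 * Real.log 2 + Real.log (2 * i))) := by
      have : Real.log (8 * i) = 2 * Real.log 2 + Real.log (2 * i) := by
        rw [show (8 * i : ℝ) = 2 ^ 2 * (2 * i) by ring, Real.log_mul (by norm_num) (by positivity),
          Real.log_pow]
        norm_num
      rw [← this, Real.exp_nat_mul, Real.exp_log (by positivity)]
    rw [h5, ← Real.exp_nat_mul]
    refine Real.exp_le_exp.2 ?_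
    have h6 := mul_le_mul_of_nonneg_left (add_le_add h1 h2) (by linarith : (0 : ℝ) ≤ i)
    push_cast
    nlinarith [h6]
  · simp only [ne_eq, OfNat.ofNat_ne_zero, not_false_eq_true, zero_pow]
    positivity

theorem eigenMajorant_le {n : ℕ} (hn : 2 ≤ n) (i : ℕ) :
    eigenMajorant n i ≤ (16 * Real.exp 1) ^ i / i.factorial + (1 / 2 : ℝ) ^ i := by
  have hx : (0 : ℝ) ≤ (16 * Real.exp 1) ^ i / i.factorial := by positivity
  have hy : (0 : ℝ) ≤ (1 / 2 : ℝ) ^ i := by positivity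
  -- The square is at most the product of the two summands on the right.
  have h : eigenMajorant n i ^ 2 ≤
      (16 * Real.exp 1) ^ i / i.factorial * (1 / 2 : ℝ) ^ i := by
    refine (eigenMajorant_sq_le hn i).trans ?_
    have h1 := Real.pow_div_factorial_le_exp i (Nat.cast_nonneg i) i
    have h2 : Real.exp i = Real.exp 1 ^ i := by rw [← Real.exp_nat_mul, mul_one]
    calc (8 * i : ℝ) ^ i / (i.factorial : ℝ) ^ 2
        = 8 ^ i / i.factorial * ((i : ℝ) ^ i / i.factorial) := by
          rw [mul_pow]; field_simp
      _ ≤ 8 ^ i / i.factorial * Real.exp 1 ^ i := by rw [← h2]; gcongr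
      _ = (16 * Real.exp 1) ^ i / i.factorial * (1 / 2 : ℝ) ^ i := by
          rw [mul_pow, one_div, inv_pow, show (16 : ℝ) = 8 * 2 by norm_num, mul_pow]
          field_simp
  exact le_of_sq_le_sq (by nlinarith) (by positivity)

theorem summable_eigenMajorant_bound :
    Summable fun i : ℕ => (16 * Real.exp 1) ^ i / i.factorial + (1 / 2 : ℝ) ^ i :=
  (Real.summable_pow_div_factorial _).add summable_geometric_two

theorem summable_eigenMajorant {n : ℕ} (hn : 2 ≤ n) : Summable (eigenMajorant n) :=
  .of_nonneg_of_le (eigenMajorant_nonneg n) (eigenMajorant_le hn) summable_eigenMajorant_bound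

theorem tendsto_tsum_eigenMajorant :
    Tendsto (fun n => ∑' i, eigenMajorant n i) atTop (𝓝 (Real.exp 1)) := by
  have he : ∑' i : ℕ, 1 / (i.factorial : ℝ) = Real.exp 1 := by
    rw [Real.exp_eq_exp_ℝ, NormedSpace.exp_eq_tsum_div]
    simp
  rw [← he]
  refine tendsto_tsum_of_dominated_convergence summable_eigenMajorant_bound
    tendsto_eigenMajorant ?_
  filter_upwards [eventually_ge_atTop 2] with n hn i
  rw [Real.norm_of_nonneg (eigenMajorant_nonneg n i)]
  exact eigenMajorant_le hn i

/-! ### Bounds on the `L²` distance -/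

theorem uepL2Dist_nonneg (n ℓ : ℕ) (J : UEPState n ℓ) (t : ℝ) : 0 ≤ uepL2Dist n ℓ J t :=
  Real.sqrt_nonneg _

theorem choose_pred_le_choose {n i : ℕ} (hi : 1 ≤ i) (hin : 2 * i ≤ n) :
    (n.choose (i - 1) : ℝ) ≤ n.choose i := by
  have h := Nat.choose_le_succ_of_lt_half_left (n := n) (r := i - 1) (by omega)
  rw [Nat.sub_add_cancel hi] at h
  exact_mod_cast h

/-- The summand `i = 1` of the exact formula is `e ^ (-4 c)`. -/
theorem exp_le_uepL2Dist {n ℓ : ℕ} (hℓ : 1 ≤ ℓ) (hn : 2 * ℓ ≤ n) (J : UEPState n ℓ) (c : ℝ) :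
    Real.exp (-2 * c) ≤
      uepL2Dist n ℓ J (1 / 4 * (n : ℝ) * Real.log ((n : ℝ) - 1) + c * n) := by
  have hn' : (2 : ℝ) ≤ n := by exact_mod_cast (by omega : 2 ≤ n)
  refine le_of_sq_le_sq ?_ (uepL2Dist_nonneg _ _ _ _)
  rw [uepL2Dist_sq (by omega)]
  refine le_trans (le_of_eq ?_) (Finset.single_le_sum (fun i hi => ?_)
    (Finset.mem_Icc.2 ⟨le_refl 1, hℓ⟩))
  · have h : -(4 * ((1 : ℕ) : ℝ) * ((n : ℝ) - (1 : ℕ) + 1) *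
        (1 / 4 * (n : ℝ) * Real.log ((n : ℝ) - 1) + c * n) / (n : ℝ) ^ 2) =
        -Real.log ((n : ℝ) - 1) + 2 * (-2 * c) := by
      push_cast
      field_simp
      ring
    rw [h, Real.exp_add, Real.exp_neg, Real.exp_log (by linarith), two_mul, Real.exp_add]
    have : (n : ℝ) - 1 ≠ 0 := by linarith
    simp
    field_simp
  · rw [Finset.mem_Icc] at hi
    exact mul_nonneg (sub_nonneg.2 (choose_pred_le_choose hi.1 (by omega))) (Real.exp_pos _).le

theorem choose_mul_exp_le_eigenMajorant {n i : ℕ} (hi : 1 ≤ i) (hn : 2 * i ≤ n) {c : ℝ}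
    (hc : 0 ≤ c) :
    (n.choose i : ℝ) * Real.exp (-(4 * (i : ℝ) * ((n : ℝ) - i + 1) *
        (1 / 4 * (n : ℝ) * Real.log ((n : ℝ) - 1) + c * n) / (n : ℝ) ^ 2)) ≤
      eigenMajorant n i * Real.exp (-4 * c) := by
  have hi' : (1 : ℝ) ≤ i := by exact_mod_cast hi
  have hn' : 2 * (i : ℝ) ≤ n := by exact_mod_cast hn
  have hn0 : (0 : ℝ) < n := by linarith
  have h1 : (n.choose i : ℝ) ≤ Real.exp (i * Real.log n) / i.factorial := by
    rw [Real.exp_nat_mul, Real.exp_log hn0]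
    exact Nat.choose_le_pow_div i n
  -- Every nonzero eigenvalue is at least the spectral gap: `i (n - i + 1) ≥ n`.
  have h2 : (n : ℝ) ≤ i * ((n : ℝ) - i + 1) := by nlinarith
  have h3 : -(4 * (i : ℝ) * ((n : ℝ) - i + 1) *
        (1 / 4 * (n : ℝ) * Real.log ((n : ℝ) - 1) + c * n) / (n : ℝ) ^ 2) ≤
      -(i * Real.log ((n : ℝ) - 1)) + i * ((i : ℝ) - 1) * (Real.log ((n : ℝ) - 1) / n) +
        -4 * c := by
    have h4 : c ≤ c * (i * ((n : ℝ) - i + 1) / n) :=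
      le_mul_of_one_le_right hc ((one_le_div hn0).2 h2)
    have h5 : -(4 * (i : ℝ) * ((n : ℝ) - i + 1) *
        (1 / 4 * (n : ℝ) * Real.log ((n : ℝ) - 1) + c * n) / (n : ℝ) ^ 2) =
      -(i * Real.log ((n : ℝ) - 1)) + i * ((i : ℝ) - 1) * (Real.log ((n : ℝ) - 1) / n) -
        4 * (c * (i * ((n : ℝ) - i + 1) / n)) := by
      field_simp
      ring
    rw [h5]
    linarith
  rw [eigenMajorant, if_pos hn]
  calc _ ≤ Real.exp (i * Real.log n) / i.factorial *
        Real.exp (-(i * Real.log ((n : ℝ) - 1)) +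
          i * ((i : ℝ) - 1) * (Real.log ((n : ℝ) - 1) / n) + -4 * c) := by gcongr
    _ = _ := by
      rw [div_mul_eq_mul_div, div_mul_eq_mul_div, ← Real.exp_add, ← Real.exp_add]
      congr 2
      ring

theorem uepL2Dist_sq_le_tsum {n ℓ : ℕ} (hℓ : 1 ≤ ℓ) (hn : 2 * ℓ ≤ n) (J : UEPState n ℓ) {c : ℝ}
    (hc : 0 ≤ c) :
    uepL2Dist n ℓ J (1 / 4 * (n : ℝ) * Real.log ((n : ℝ) - 1) + c * n) ^ 2 ≤
      (∑' i, eigenMajorant n i) * Real.exp (-4 * c) := by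
  rw [uepL2Dist_sq (by omega)]
  calc _ ≤ ∑ i ∈ Finset.Icc 1 ℓ, eigenMajorant n i * Real.exp (-4 * c) := by
        refine Finset.sum_le_sum fun i hi => ?_
        rw [Finset.mem_Icc] at hi
        refine le_trans ?_ (choose_mul_exp_le_eigenMajorant hi.1 (by omega) hc)
        gcongr
        exact sub_le_self _ (Nat.cast_nonneg _)
    _ ≤ _ := by
        rw [← Finset.sum_mul]
        gcongr
        exact (summable_eigenMajorant (by omega)).sum_le_tsum _ fun i _ => eigenMajorant_nonneg n i

theorem exists_forall_uepL2Dist_le :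
    ∃ N : ℕ, ∀ n : ℕ, N ≤ n → ∀ ℓ : ℕ, 1 ≤ ℓ → 2 * ℓ ≤ n →
      ∀ (J : UEPState n ℓ) (c : ℝ), 0 ≤ c →
      uepL2Dist n ℓ J (1 / 4 * (n : ℝ) * Real.log ((n : ℝ) - 1) + c * n) ≤
        2 * Real.exp (-2 * c) := by
  have he : Real.exp 1 < 4 := Real.exp_one_lt_three.trans (by norm_num)
  obtain ⟨N, hN⟩ := eventually_atTop.1 (tendsto_tsum_eigenMajorant.eventually (gt_mem_nhds he))
  refine ⟨N, fun n hNn ℓ hℓ hn J c hc => le_of_sq_le_sq ?_ (by positivity)⟩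
  refine (uepL2Dist_sq_le_tsum hℓ hn J hc).trans ?_
  calc _ ≤ 4 * Real.exp (-4 * c) := by gcongr; exact (hN n hNn).le
    _ = (2 * Real.exp (-2 * c)) ^ 2 := by
      rw [mul_pow, ← Real.exp_nat_mul]
      norm_num
      ring_nf

/-! ### The mixing time -/

/-- One shift `c` mixes the process for all `n` and `ℓ`, as the convergent sequence of majorants
is bounded. -/
theorem exists_forall_mem_uepL2MixedTimes {ε : ℝ} (hε : 0 < ε) :
    ∃ c : ℝ, 0 ≤ c ∧ ∀ n ℓ : ℕ, 1 ≤ ℓ → 2 * ℓ ≤ n →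
      1 / 4 * (n : ℝ) * Real.log ((n : ℝ) - 1) + c * n ∈ uepL2MixedTimes n ℓ ε := by
  obtain ⟨M, hM⟩ := tendsto_tsum_eigenMajorant.bddAbove_range
  have hlim : Tendsto (fun c : ℝ => M * Real.exp (-4 * c)) atTop (𝓝 (M * 0)) :=
    (Real.tendsto_exp_atBot.comp
      (tendsto_id.const_mul_atTop_of_neg (by norm_num : (-4 : ℝ) < 0))).const_mul M
  rw [mul_zero] at hlim
  obtain ⟨c, hcM, hc⟩ := ((hlim.eventually
    (gt_mem_nhds (show (0 : ℝ) < (2 * ε) ^ 2 by positivity))).and (eventually_ge_atTop 0)).exists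
  refine ⟨c, hc, fun n ℓ hℓ hn => ⟨?_, fun J => le_of_sq_le_sq ?_ (by positivity)⟩⟩
  · have hn' : (2 : ℝ) ≤ n := by exact_mod_cast (by omega : 2 ≤ n)
    have := Real.log_nonneg (by linarith : (1 : ℝ) ≤ (n : ℝ) - 1)
    positivity
  · refine (uepL2Dist_sq_le_tsum hℓ hn J hc).trans (le_trans ?_ hcM.le)
    gcongr
    exact hM ⟨n, rfl⟩

theorem le_of_mem_uepL2MixedTimes {n ℓ : ℕ} (hℓ : 1 ≤ ℓ) (hn : 2 * ℓ ≤ n) {ε t : ℝ} (hε : 0 < ε)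
    (ht : t ∈ uepL2MixedTimes n ℓ ε) :
    1 / 4 * (n : ℝ) * Real.log ((n : ℝ) - 1) - Real.log (2 * ε) / 2 * n ≤ t := by
  have hn0 : (0 : ℝ) < n := by exact_mod_cast (by omega : 0 < n)
  obtain ⟨J⟩ : Nonempty (UEPState n ℓ) := by
    rw [← Fintype.card_pos_iff, card_uepState]
    exact Nat.choose_pos (by omega)
  have h := (exp_le_uepL2Dist hℓ hn J (t / n - 1 / 4 * Real.log ((n : ℝ) - 1))).trans
    (le_of_eq (by congr 1; field_simp; ring) |>.trans (ht.2 J))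
  rw [← Real.le_log_iff_exp_le (by positivity)] at h
  have h2 : 1 / 4 * Real.log ((n : ℝ) - 1) - Real.log (2 * ε) / 2 ≤ t / n := by linarith
  rw [le_div_iff₀ hn0] at h2
  linarith

theorem exists_forall_abs_uepL2MixingTime_sub_le {ε : ℝ} (hε : 0 < ε) :
    ∃ C : ℝ, ∀ n ℓ : ℕ, 1 ≤ ℓ → 2 * ℓ ≤ n →
      (uepL2MixedTimes n ℓ ε).Nonempty ∧
      |uepL2MixingTime n ℓ ε - 1 / 4 * (n : ℝ) * Real.log n| ≤ C * n := by
  obtain ⟨c, hc, hmem⟩ := exists_forall_mem_uepL2MixedTimes hε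
  refine ⟨c + Real.log 2 / 4 + |Real.log (2 * ε)| / 2, fun n ℓ hℓ hn => ⟨⟨_, hmem n ℓ hℓ hn⟩, ?_⟩⟩
  have hn' : (2 : ℝ) ≤ n := by exact_mod_cast (by omega : 2 ≤ n)
  have hup : uepL2MixingTime n ℓ ε ≤ 1 / 4 * (n : ℝ) * Real.log ((n : ℝ) - 1) + c * n :=
    csInf_le ⟨0, fun t ht => ht.1⟩ (hmem n ℓ hℓ hn)
  have hlo : 1 / 4 * (n : ℝ) * Real.log ((n : ℝ) - 1) - Real.log (2 * ε) / 2 * n ≤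
      uepL2MixingTime n ℓ ε :=
    le_csInf ⟨_, hmem n ℓ hℓ hn⟩ fun t ht => le_of_mem_uepL2MixedTimes hℓ hn hε ht
  have h1 : (n : ℝ) * Real.log ((n : ℝ) - 1) ≤ n * Real.log n := by
    gcongr
    · linarith
    · linarith
  have h2 : (n : ℝ) * Real.log n ≤ n * (Real.log 2 + Real.log ((n : ℝ) - 1)) := by
    rw [← Real.log_mul (by norm_num) (by linarith)]
    gcongr
    linarith
  have h3 : Real.log (2 * ε) * n ≤ |Real.log (2 * ε)| * n := by gcongr; exact le_abs_self _
  have h4 : 0 ≤ Real.log 2 * n := mul_nonneg (Real.log_nonneg one_le_two) (by linarith)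
  have h5 : 0 ≤ |Real.log (2 * ε)| * n := by positivity
  have h6 : 0 ≤ c * n := by positivity
  rw [abs_le]
  constructor <;> linarith

theorem theorem1p3 :
    -- the exact formula
    (∀ n ℓ : ℕ, 1 ≤ ℓ → 2 * ℓ ≤ n → ∀ (J : UEPState n ℓ) (t : ℝ), 0 ≤ t →
      uepL2Dist n ℓ J t ^ 2 =
        ∑ i ∈ Finset.Icc 1 ℓ, ((n.choose i : ℝ) - (n.choose (i - 1) : ℝ)) *
          Real.exp (-(4 * (i : ℝ) * ((n : ℝ) - i + 1) * t / (n : ℝ) ^ 2))) ∧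
    -- the lower bound, at every time `t ≥ 0` written as `(1/4) n log (n - 1) + c n`
    (∀ n ℓ : ℕ, 1 ≤ ℓ → 2 * ℓ ≤ n → ∀ (J : UEPState n ℓ) (c : ℝ),
      0 ≤ 1 / 4 * (n : ℝ) * Real.log ((n : ℝ) - 1) + c * n →
      Real.exp (-2 * c) ≤
        uepL2Dist n ℓ J (1 / 4 * (n : ℝ) * Real.log ((n : ℝ) - 1) + c * n)) ∧
    -- the upper bound, for `c ≥ 0` and all large `n`, uniformly in `ℓ`, `J` and `c`
    (∃ N : ℕ, ∀ n : ℕ, N ≤ n → ∀ ℓ : ℕ, 1 ≤ ℓ → 2 * ℓ ≤ n →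
      ∀ (J : UEPState n ℓ) (c : ℝ), 0 ≤ c →
      uepL2Dist n ℓ J (1 / 4 * (n : ℝ) * Real.log ((n : ℝ) - 1) + c * n) ≤
        2 * Real.exp (-2 * c)) ∧
    -- the mixing time (an infimum over a nonempty set of times)
    (∀ ε : ℝ, 0 < ε → ε < 1 → ∃ C : ℝ, ∀ n ℓ : ℕ, 1 ≤ ℓ → 2 * ℓ ≤ n →
      (uepL2MixedTimes n ℓ ε).Nonempty ∧
      |uepL2MixingTime n ℓ ε - 1 / 4 * (n : ℝ) * Real.log n| ≤ C * n) :=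
  ⟨fun _ _ _ hn J t _ => uepL2Dist_sq (by omega) J t,
    fun _ _ hℓ hn J c _ => exp_le_uepL2Dist hℓ hn J c,
    exists_forall_uepL2Dist_le,
    fun _ hε _ => exists_forall_abs_uepL2MixingTime_sub_le hε⟩
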